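/- Let $\mathcal H$ be a (real or complex) Hilbert space with inner product linear in the first variable, $I$ a countable index set and $\Psi=\{\psi_i\}_{i\in I}$ a family in $\mathcal H$. The analysis operator $C_\Psi:\operatorname{dom}C_\Psi\subseteq\mathcal H\to\ell^2(I)$ is $C_\Psi f=\{\langle f,\psi_i\rangle\}_{i\in I}$ with domain all $f$ for which this family is in $\ell^2(I)$. The synthesis operator $D_\Psi:\operatorname{dom}D_\Psi\subseteq\ell^2(I)\to\mathcal H$ is $D_\Psi c=\sum_{i}c_i\psi_i$ with domain all $c\in\ell^2(I)$ for which the series converges. (Convergence of series is with respect to any fixed mode of summation under which unconditionally convergent series keep their sum, e.g. convergence of the partial sums along a fixed enumeration of $I$, or unconditional convergence.) Put $\mathcal H_\Psi=\overline{\operatorname{dom}C_\Psi}$, let $\pi$ be the orthogonal projection of $\mathcal H$ onto $\mathcal H_\Psi$, and let $C_\Psi^r:\operatorname{dom}C_\Psi^r\subseteq\mathcal H_\Psi\to\ell^2(I)$ and $D_\Psi^r:\operatorname{dom}D_\Psi^r\subseteq\ell^2(I)\to\mathcal H_\Psi$ be the analysis and synthesis operators of the family $\{\pi\psi_i\}_{i\in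 I}$ in the Hilbert space $\mathcal H_\Psi$. Let $\Gamma_\Psi=(C_\Psi^r)^*C_\Psi^r$, an operator in $\mathcal H_\Psi$. For a densely defined closed operator $T$ from a Hilbert space $\mathcal H_1$ to a Hilbert space $\mathcal H_2$, a linear operator $S:\operatorname{dom}S\subseteq\mathcal H_2\to\mathcal H_1$ is called a pseudo-inverse of $T$ if $\overline{\operatorname{ran}S}=(\ker T)^\perp$, $\ker S=(\operatorname{ran}T)^\perp$ and $TST=T$ (including equality of domains). If there is exactly one such $S$, it is denoted by $T^\dagger$. **Theorem.** Let $\Psi$ be a lower frame sequence in $\mathcal H$, i.e. there is $A>0$ with $\sqrt A\,\|f\|\le\|C_\Psi f\|$ for all $f\in\operatorname{dom}C_\Psi$. Then $\Gamma_\Psi:\operatorname{dom}\Gamma_\Psi\to\mathcal H_\Psi$ is bijective, so that the canonical dual $\widetilde\psi_i=\Gamma_\Psi^{-1}\pi\psi_i$ $(i\in I)$ is well defined; the operator $D_\Psi^r$ is closable; and its closure $\overline{D_\Psi^r}$ has exactly one pseudo-inverse, which is defined on all of $\mathcal H_\Psi$ and given by $$\overline{D_\Psi^r}^{\,\dagger}f=\{\langle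 f,\widetilde\psi_i\rangle\}_{i\in I}\qquad(f\in\mathcal H_\Psi).$$ In particular, if $D_\Psi$ is closable, then its closure $\overline{D_\Psi}$ has exactly one pseudo-inverse, which is defined on all of $\mathcal H$ and given by $$\overline{D_\Psi}^{\,\dagger}f=\{\langle f,\widetilde\psi_i\rangle\}_{i\in I}\qquad(f\in\mathcal H).$$ -/

import Mathlib

open scoped InnerProductSpace

noncomputable section

namespace LowerFrame

/-- The natural composition `S ∘ T` of partially defined operators, with domain
`{x ∈ dom T | T x ∈ dom S}`. -/
def pcomp {𝕜 E F G : Type*} [RCLike 𝕜] [AddCommGroup E] [Module 𝕜 E] [AddCommGroup F] [Module 𝕜 F]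
    [AddCommGroup G] [Module 𝕜 G] (S : F →ₗ.[𝕜] G) (T : E →ₗ.[𝕜] F) : E →ₗ.[𝕜] G where
  domain := (S.domain.comap T.toFun).map T.domain.subtype
  toFun :=
    { toFun := fun x => S ⟨T ⟨x, by
          obtain ⟨y, -, hy⟩ := x.2
          exact hy ▸ y.2⟩, by
          obtain ⟨_, z, hz, rfl⟩ := x
          exact hz⟩
      map_add' := fun x y => by
        rw [← LinearPMap.map_add]
        congr 1
        apply Subtype.ext
        exact LinearPMap.map_add T ⟨x, _⟩ ⟨y, _⟩
      map_smul' := fun c x => by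
        rw [RingHom.id_apply, ← LinearPMap.map_smul]
        congr 1
        apply Subtype.ext
        exact LinearPMap.map_smul T c ⟨x, _⟩ }

/-- The null space of a partially defined operator, as a subspace of the ambient space. -/
def nullSpace {𝕜 E F : Type*} [RCLike 𝕜] [AddCommGroup E] [Module 𝕜 E] [AddCommGroup F]
    [Module 𝕜 F] (T : E →ₗ.[𝕜] F) : Submodule 𝕜 E :=
  (LinearMap.ker T.toFun).map T.domain.subtype

/-- The range of a partially defined operator. -/
def ran {𝕜 E F : Type*} [RCLike 𝕜] [AddCommGroup E] [Module 𝕜 E] [AddCommGroup F]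
    [Module 𝕜 F] (T : E →ₗ.[𝕜] F) : Submodule 𝕜 F :=
  LinearMap.range T.toFun

/-- `S` is a pseudo-inverse of the (closed, densely defined) operator `T`: the closure of the range
of `S` is `(ker T)ᗮ`, the null space of `S` is `(ran T)ᗮ`, and `T S T = T` (an identity of
partially defined operators, domains included). -/
structure IsPseudoInverse {𝕜 E F : Type*} [RCLike 𝕜] [NormedAddCommGroup E] [InnerProductSpace 𝕜 E]
    [NormedAddCommGroup F] [InnerProductSpace 𝕜 F] (T : E →ₗ.[𝕜] F) (S : F →ₗ.[𝕜] E) : Prop where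
  closure_ran : (ran S).topologicalClosure = (nullSpace T)ᗮ
  nullSpace_eq : nullSpace S = (ran T)ᗮ
  comp_eq : pcomp T (pcomp S T) = T

section Operators

variable (𝕜 : Type*) {H I : Type*} [RCLike 𝕜] [NormedAddCommGroup H] [InnerProductSpace 𝕜 H]

/-- The Hilbert space `ℓ²(I)`. -/
abbrev ell2 (I : Type*) : Type _ := lp (fun _ : I => 𝕜) 2

/-- The analysis operator `C f = (⟨f, ψ i⟩)_i`, whose domain consists of all `f` for which this
family is square summable. (Mathlib's inner product is linear in the second variable.) -/
def analysisOp (Ψ : I → H) : H →ₗ.[𝕜] ell2 𝕜 I where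
  domain :=
    { carrier := {f | Memℓp (fun i => ⟪Ψ i, f⟫_𝕜) 2}
      zero_mem' := by
        have : (fun i => ⟪Ψ i, (0 : H)⟫_𝕜) = 0 := by ext; simp
        change Memℓp _ 2
        rw [this]
        exact zero_memℓp
      add_mem' := fun {f g} hf hg => by
        have : (fun i => ⟪Ψ i, f + g⟫_𝕜) = (fun i => ⟪Ψ i, f⟫_𝕜) + fun i => ⟪Ψ i, g⟫_𝕜 := by
          ext; simp [inner_add_right]
        change Memℓp _ 2
        rw [this]
        exact Memℓp.add hf hg
      smul_mem' := fun c f hf => by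
        have : (fun i => ⟪Ψ i, c • f⟫_𝕜) = c • fun i => ⟪Ψ i, f⟫_𝕜 := by
          ext; simp [inner_smul_right]
        change Memℓp _ 2
        rw [this]
        exact Memℓp.const_smul hf c }
  toFun :=
    { toFun := fun f => ⟨fun i => ⟪Ψ i, (f : H)⟫_𝕜, f.2⟩
      map_add' := fun f g => by ext i; exact inner_add_right _ _ _
      map_smul' := fun c f => by ext i; exact inner_smul_right _ _ _ }

/-- The synthesis operator `D c = ∑ i, c i • ψ i`, whose domain consists of all `c ∈ ℓ²(I)` for
which this series converges. Convergence is understood along the summation filter `L`: for instance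
convergence of the partial sums with respect to a fixed enumeration of `I`, or unconditional
convergence. -/
def synthesisOp (L : SummationFilter I) [L.NeBot] (Ψ : I → H) : ell2 𝕜 I →ₗ.[𝕜] H where
  domain :=
    { carrier := {c | Summable (fun i => c i • Ψ i) L}
      zero_mem' := by simp
      add_mem' := fun {c d} hc hd => by
        change Summable (fun i => (c + d) i • Ψ i) L
        simpa [add_smul] using Summable.add hc hd
      smul_mem' := fun a c hc => by
        change Summable (fun i => (a • c) i • Ψ i) L
        simpa [mul_smul] using Summable.const_smul a hc }
  toFun :=
    { toFun := fun c => ∑'[L] i, (c : ell2 𝕜 I) i • Ψ i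
      map_add' := fun c d => by
        simpa [add_smul] using Summable.tsum_add c.2 d.2
      map_smul' := fun a c => by
        simpa [mul_smul] using Summable.tsum_const_smul a c.2 }

/-- `Ψ` is a lower frame sequence: for some `A > 0`, `√A ‖f‖ ≤ ‖C f‖` for all `f ∈ dom C`. -/
def IsLowerFrameSequence (Ψ : I → H) : Prop :=
  ∃ A : ℝ, 0 < A ∧ ∀ f : (analysisOp 𝕜 Ψ).domain, √A * ‖(f : H)‖ ≤ ‖analysisOp 𝕜 Ψ f‖

/-- The Hilbert space `H_Ψ`, the closure of the domain of the analysis operator. -/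
abbrev spaceOf (Ψ : I → H) : Submodule 𝕜 H := (analysisOp 𝕜 Ψ).domain.topologicalClosure

variable [CompleteSpace H]

/-- The orthogonal projection of the sequence `Ψ` to `H_Ψ`, as a sequence in `H_Ψ`. -/
def restrictSeq (Ψ : I → H) (i : I) : spaceOf 𝕜 Ψ := (spaceOf 𝕜 Ψ).orthogonalProjectionOnto (Ψ i)

/-- The restricted analysis operator `C^r`, from `H_Ψ` to `ℓ²(I)`. -/
def analysisOpR (Ψ : I → H) : spaceOf 𝕜 Ψ →ₗ.[𝕜] ell2 𝕜 I := analysisOp 𝕜 (restrictSeq 𝕜 Ψ)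

/-- The restricted synthesis operator `D^r`, from `ℓ²(I)` to `H_Ψ`. -/
def synthesisOpR (L : SummationFilter I) [L.NeBot] (Ψ : I → H) : ell2 𝕜 I →ₗ.[𝕜] spaceOf 𝕜 Ψ :=
  synthesisOp 𝕜 L (restrictSeq 𝕜 Ψ)

/-- The generalized frame operator `Γ = (C^r)* C^r` in `H_Ψ`, where the (unbounded) adjoint is
taken between `H_Ψ` and `ℓ²(I)`. -/
def genFrameOp (Ψ : I → H) : spaceOf 𝕜 Ψ →ₗ.[𝕜] spaceOf 𝕜 Ψ :=
  pcomp (analysisOpR 𝕜 Ψ).adjoint (analysisOpR 𝕜 Ψ)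

open Classical in
/-- The canonical dual `ψ̃ i = Γ⁻¹ π ψ i`, where `π` is the orthogonal projection to `H_Ψ` (with the
value `0` in case `π ψ i` is not in the domain of `Γ⁻¹`, which is the range of `Γ`). -/
def canonicalDual (Ψ : I → H) (i : I) : spaceOf 𝕜 Ψ :=
  if h : restrictSeq 𝕜 Ψ i ∈ (genFrameOp 𝕜 Ψ).inverse.domain then
    (genFrameOp 𝕜 Ψ).inverse ⟨restrictSeq 𝕜 Ψ i, h⟩
  else 0

end Operators

end LowerFrame

end

open scoped InnerProductSpace

namespace LowerFrame

section Graph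

variable {𝕜 E F G : Type*} [RCLike 𝕜] [AddCommGroup E] [Module 𝕜 E] [AddCommGroup F] [Module 𝕜 F]
  [AddCommGroup G] [Module 𝕜 G]

lemma mem_graph_pcomp_iff {S : F →ₗ.[𝕜] G} {T : E →ₗ.[𝕜] F} {x : E} {z : G} :
    (x, z) ∈ (pcomp S T).graph ↔ ∃ y, (x, y) ∈ T.graph ∧ (y, z) ∈ S.graph := by
  constructor
  · intro h
    obtain ⟨w, hw, hz⟩ := (LinearPMap.mem_graph_iff _).1 h
    obtain ⟨_, v, hv, rfl⟩ := w
    obtain rfl : (v : E) = x := hw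
    obtain rfl : S ⟨T v, hv⟩ = z := hz
    exact ⟨T v, LinearPMap.mem_graph _ _, LinearPMap.mem_graph S ⟨T v, hv⟩⟩
  · rintro ⟨y, h1, h2⟩
    obtain ⟨v, rfl, rfl⟩ := (LinearPMap.mem_graph_iff _).1 h1
    obtain ⟨w, hw, rfl⟩ := (LinearPMap.mem_graph_iff _).1 h2
    obtain ⟨w, hw'⟩ := w
    obtain rfl : w = T v := hw
    exact (LinearPMap.mem_graph_iff _).2 ⟨⟨v, v, hw', rfl⟩, rfl, rfl⟩

lemma mem_nullSpace_iff {T : E →ₗ.[𝕜] F} {x : E} : x ∈ nullSpace T ↔ (x, 0) ∈ T.graph := by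
  constructor
  · rintro ⟨v, hv, rfl⟩
    exact (LinearPMap.mem_graph_iff _).2 ⟨v, rfl, hv⟩
  · intro h
    obtain ⟨v, rfl, hv⟩ := (LinearPMap.mem_graph_iff _).1 h
    exact ⟨v, hv, rfl⟩

lemma mem_ran_iff {T : E →ₗ.[𝕜] F} {y : F} : y ∈ ran T ↔ ∃ x, (x, y) ∈ T.graph := by
  constructor
  · rintro ⟨v, rfl⟩
    exact ⟨v, LinearPMap.mem_graph _ _⟩
  · rintro ⟨x, h⟩
    obtain ⟨v, rfl, rfl⟩ := (LinearPMap.mem_graph_iff _).1 h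
    exact ⟨v, rfl⟩

lemma mem_graph_toPMap_top_iff {S : E →ₗ[𝕜] F} {x : E} {y : F} :
    (x, y) ∈ (S.toPMap ⊤).graph ↔ S x = y := by
  rw [LinearPMap.mem_graph_iff]
  constructor
  · rintro ⟨v, rfl, h⟩
    exact h
  · intro h
    exact ⟨⟨x, trivial⟩, rfl, h⟩

end Graph

section PseudoInverse

variable {𝕜 E F : Type*} [RCLike 𝕜] [NormedAddCommGroup E] [InnerProductSpace 𝕜 E]
  [NormedAddCommGroup F] [InnerProductSpace 𝕜 F]

/-- A right inverse of `T` with range dense in `(ker T)ᗮ` is the only pseudo-inverse of `T`. -/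
lemma isPseudoInverse_iff_eq_toPMap {T : E →ₗ.[𝕜] F} {S : F →ₗ[𝕜] E}
    (hTS : ∀ f, (S f, f) ∈ T.graph)
    (hran : (LinearMap.range S).topologicalClosure = (nullSpace T)ᗮ) (S' : F →ₗ.[𝕜] E) :
    IsPseudoInverse T S' ↔ S' = S.toPMap ⊤ := by
  have hS : ∀ f, S f ∈ (nullSpace T)ᗮ := fun f =>
    hran ▸ Submodule.le_topologicalClosure _ ⟨f, rfl⟩
  have hranT : ran T = ⊤ := (Submodule.eq_top_iff').2 fun f => mem_ran_iff.2 ⟨_, hTS f⟩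
  constructor
  · intro h
    have key : ∀ f, (f, S f) ∈ S'.graph := by
      intro f
      have h1 := hTS f
      rw [← h.comp_eq] at h1
      obtain ⟨y, h2, hy⟩ := mem_graph_pcomp_iff.1 h1
      obtain ⟨f', h3, h4⟩ := mem_graph_pcomp_iff.1 h2
      obtain rfl : f = f' := LinearPMap.mem_graph_snd_inj T (hTS f) h3 rfl
      have hy' : y ∈ (nullSpace T)ᗮ := by
        rw [← h.closure_ran]
        exact Submodule.le_topologicalClosure _ (mem_ran_iff.2 ⟨f, h4⟩)
      have h5 : y - S f ∈ nullSpace T := by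
        rw [mem_nullSpace_iff]
        simpa using T.graph.sub_mem hy (hTS f)
      have h6 : y - S f = 0 := by
        have := Submodule.sub_mem _ hy' (hS f) (y - S f) h5
        exact inner_self_eq_zero.1 this
      rwa [← sub_eq_zero.1 h6]
    apply LinearPMap.eq_of_eq_graph
    ext ⟨f, x⟩
    rw [mem_graph_toPMap_top_iff]
    exact ⟨fun hx => LinearPMap.mem_graph_snd_inj S' (key f) hx rfl, fun hx => hx ▸ key f⟩
  · rintro rfl
    refine ⟨?_, ?_, ?_⟩
    · rw [← hran]
      congr 1
      ext x
      rw [mem_ran_iff]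
      simp
    · rw [hranT, Submodule.top_orthogonal_eq_bot]
      refine (Submodule.eq_bot_iff _).2 fun f hf => ?_
      rw [mem_nullSpace_iff, mem_graph_toPMap_top_iff] at hf
      have := hTS f
      rw [hf] at this
      exact LinearPMap.graph_fst_eq_zero_snd T this rfl
    · apply LinearPMap.eq_of_eq_graph
      ext ⟨x, f⟩
      rw [mem_graph_pcomp_iff]
      constructor
      · rintro ⟨y, h1, h2⟩
        obtain ⟨f', h3, h4⟩ := mem_graph_pcomp_iff.1 h1
        rw [mem_graph_toPMap_top_iff] at h4
        subst h4
        obtain rfl : f' = f := LinearPMap.mem_graph_snd_inj T (hTS f') h2 rfl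
        exact h3
      · intro h
        exact ⟨S f, mem_graph_pcomp_iff.2 ⟨f, h, mem_graph_toPMap_top_iff.2 rfl⟩, hTS f⟩

end PseudoInverse

section Family

variable {𝕜 X I : Type*} [RCLike 𝕜] [NormedAddCommGroup X] [InnerProductSpace 𝕜 X]

lemma analysisOp_apply (Φ : I → X) (f : (analysisOp 𝕜 Φ).domain) (i : I) :
    (analysisOp 𝕜 Φ f : ell2 𝕜 I) i = ⟪Φ i, (f : X)⟫_𝕜 := rfl

lemma mem_graph_analysisOp_iff {Φ : I → X} {f : X} {c : ell2 𝕜 I} :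
    (f, c) ∈ (analysisOp 𝕜 Φ).graph ↔ ∀ i, c i = ⟪Φ i, f⟫_𝕜 := by
  constructor
  · intro h i
    obtain ⟨v, rfl, rfl⟩ := (LinearPMap.mem_graph_iff _).1 h
    rfl
  · intro h
    have hf : f ∈ (analysisOp 𝕜 Φ).domain := by
      change Memℓp (fun i => ⟪Φ i, f⟫_𝕜) 2
      rw [← show (c : I → 𝕜) = fun i => ⟪Φ i, f⟫_𝕜 from funext h]
      exact lp.memℓp c
    refine (LinearPMap.mem_graph_iff _).2 ⟨⟨f, hf⟩, rfl, ?_⟩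
    ext i
    exact (h i).symm

lemma inner_synthesisOp (L : SummationFilter I) [L.NeBot] [L.LeAtTop] (Φ : I → X)
    (c : (synthesisOp 𝕜 L Φ).domain) (f : (analysisOp 𝕜 Φ).domain) :
    ⟪synthesisOp 𝕜 L Φ c, (f : X)⟫_𝕜 = ⟪(c : ell2 𝕜 I), analysisOp 𝕜 Φ f⟫_𝕜 := by
  have h1 : HasSum (fun i => (c : ell2 𝕜 I) i • Φ i) (synthesisOp 𝕜 L Φ c) L :=
    Summable.hasSum c.2
  have h2 := (h1.mapL (innerSL 𝕜 (f : X)))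
  have h3 : HasSum (fun i => ⟪(analysisOp 𝕜 Φ f : ell2 𝕜 I) i, (c : ell2 𝕜 I) i⟫_𝕜)
      ⟪analysisOp 𝕜 Φ f, (c : ell2 𝕜 I)⟫_𝕜 L :=
    (lp.hasSum_inner (analysisOp 𝕜 Φ f) (c : ell2 𝕜 I)).mono_left L.le_atTop
  have h4 : ⟪(f : X), synthesisOp 𝕜 L Φ c⟫_𝕜 = ⟪analysisOp 𝕜 Φ f, (c : ell2 𝕜 I)⟫_𝕜 := by
    refine HasSum.unique (L := L) h2 ?_
    convert h3 using 2 with i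
    simp [analysisOp_apply]
  rw [← inner_conj_symm, h4, inner_conj_symm]

lemma single_mem_graph_synthesisOp [DecidableEq I] (L : SummationFilter I) [L.NeBot] [L.LeAtTop]
    (Φ : I → X) (i : I) :
    (lp.single 2 i (1 : 𝕜), Φ i) ∈ (synthesisOp 𝕜 L Φ).graph := by
  have h : HasSum (fun j => (lp.single 2 i (1 : 𝕜) : ell2 𝕜 I) j • Φ j) (Φ i) L := by
    have := hasSum_single (L := L) (f := fun j => (lp.single 2 i (1 : 𝕜) : ell2 𝕜 I) j • Φ j) i
      (fun j hj => by simp [hj])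
    simpa using this
  exact (LinearPMap.mem_graph_iff _).2 ⟨⟨_, h.summable⟩, rfl, h.tsum_eq⟩

lemma IsLowerFrameSequence.injective_analysisOp {Φ : I → X} (hΦ : IsLowerFrameSequence 𝕜 Φ) :
    Function.Injective (analysisOp 𝕜 Φ).toFun := by
  obtain ⟨A, hA, h⟩ := hΦ
  refine (injective_iff_map_eq_zero _).2 fun f hf => ?_
  have h1 := h f
  rw [show analysisOp 𝕜 Φ f = 0 from hf, norm_zero] at h1
  have h2 : ‖(f : X)‖ ≤ 0 := nonpos_of_mul_nonpos_right h1 (Real.sqrt_pos.2 hA)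
  exact Subtype.ext (norm_le_zero_iff.1 h2)

lemma isClosed_graph_analysisOp (Φ : I → X) :
    IsClosed ((analysisOp 𝕜 Φ).graph : Set (X × ell2 𝕜 I)) := by
  have : ((analysisOp 𝕜 Φ).graph : Set (X × ell2 𝕜 I)) =
      ⋂ i, {p | p.2 i = ⟪Φ i, p.1⟫_𝕜} := by
    ext ⟨f, c⟩
    rw [SetLike.mem_coe, mem_graph_analysisOp_iff, Set.mem_iInter]
    rfl
  rw [this]
  refine isClosed_iInter fun i => isClosed_eq ?_ (by fun_prop)
  exact (lp.evalCLM 𝕜 (fun _ : I => 𝕜) 2 i).continuous.comp continuous_snd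

variable [CompleteSpace X]

/-- The closed graph of the synthesis operator is the graph of the adjoint of the analysis
operator. -/
lemma mem_closure_graph_synthesisOp_iff (L : SummationFilter I) [L.NeBot] [L.LeAtTop] (Φ : I → X)
    {c : ell2 𝕜 I} {g : X} :
    (c, g) ∈ (synthesisOp 𝕜 L Φ).graph.topologicalClosure ↔
      ∀ f : (analysisOp 𝕜 Φ).domain, ⟪g, (f : X)⟫_𝕜 = ⟪c, analysisOp 𝕜 Φ f⟫_𝕜 := by
  classical
  constructor
  · intro h f
    have hcl : IsClosed {p : ell2 𝕜 I × X | ⟪p.2, (f : X)⟫_𝕜 = ⟪p.1, analysisOp 𝕜 Φ f⟫_𝕜} :=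
      isClosed_eq (by fun_prop) (by fun_prop)
    refine closure_minimal ?_ hcl h
    rintro ⟨d, y⟩ hd
    obtain ⟨v, rfl, rfl⟩ := (LinearPMap.mem_graph_iff _).1 hd
    exact inner_synthesisOp L Φ v f
  · intro h
    let e := WithLp.prodContinuousLinearEquiv 2 𝕜 (ell2 𝕜 I) X
    let M := (synthesisOp 𝕜 L Φ).graph.map (e.symm : _ →ₗ[𝕜] WithLp 2 (ell2 𝕜 I × X))
    have hM : e.symm (c, g) ∈ M.topologicalClosure := by
      rw [← Submodule.orthogonal_orthogonal_eq_closure, Submodule.mem_orthogonal]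
      intro u hu
      obtain ⟨⟨d, y⟩, rfl⟩ := e.symm.surjective u
      have hd : ∀ a b, (a, b) ∈ (synthesisOp 𝕜 L Φ).graph → ⟪a, d⟫_𝕜 + ⟪b, y⟫_𝕜 = 0 := by
        intro a b hab
        have := (Submodule.mem_orthogonal _ _).1 hu (e.symm (a, b)) ⟨(a, b), hab, rfl⟩
        simpa [e, WithLp.prod_inner_apply] using this
      have hdy : (y, -d) ∈ (analysisOp 𝕜 Φ).graph := by
        rw [mem_graph_analysisOp_iff]
        intro i
        have := hd _ _ (single_mem_graph_synthesisOp L Φ i)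
        rw [lp.inner_single_left] at this
        simp at this
        simp
        linear_combination (-1 : 𝕜) * this
      obtain ⟨v, rfl, hv⟩ := (LinearPMap.mem_graph_iff _).1 hdy
      have := h v
      have h0 : ⟪(v : X), g⟫_𝕜 = ⟪analysisOp 𝕜 Φ v, c⟫_𝕜 := by
        rw [← inner_conj_symm, this, inner_conj_symm]
      rw [hv] at h0
      simp [e, WithLp.prod_inner_apply, h0]
    have h2 : e (e.symm (c, g)) ∈ closure (e '' (M : Set _)) :=
      image_closure_subset_closure_image e.continuous ⟨_, hM, rfl⟩
    have h3 : e '' (M : Set (WithLp 2 (ell2 𝕜 I × X))) = (synthesisOp 𝕜 L Φ).graph := by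
      simp only [M, Submodule.map_coe, Set.image_image]
      simp
    rw [h3, e.apply_symm_apply] at h2
    exact h2

lemma isClosable_synthesisOp_iff (L : SummationFilter I) [L.NeBot] [L.LeAtTop] (Φ : I → X) :
    (synthesisOp 𝕜 L Φ).IsClosable ↔ Dense ((analysisOp 𝕜 Φ).domain : Set X) := by
  constructor
  · rintro ⟨T, hT⟩
    rw [Submodule.dense_iff_topologicalClosure_eq_top, Submodule.topologicalClosure_eq_top_iff,
      Submodule.eq_bot_iff]
    intro g hg
    refine LinearPMap.graph_fst_eq_zero_snd T (x := 0) ?_ rfl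
    rw [← hT, mem_closure_graph_synthesisOp_iff]
    intro f
    rw [inner_zero_left]
    exact (Submodule.mem_orthogonal' _ _).1 hg f f.2
  · intro hd
    refine ⟨_, (Submodule.toLinearPMap_graph_eq _ ?_).symm⟩
    rintro ⟨c, g⟩ h hc
    obtain rfl : c = 0 := hc
    rw [mem_closure_graph_synthesisOp_iff] at h
    refine hd.eq_zero_of_inner_left 𝕜 fun f hf => ?_
    simpa using h ⟨f, hf⟩

lemma mem_graph_closure_synthesisOp_iff (L : SummationFilter I) [L.NeBot] [L.LeAtTop] {Φ : I → X}
    (hd : Dense ((analysisOp 𝕜 Φ).domain : Set X)) {c : ell2 𝕜 I} {g : X} :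
    (c, g) ∈ (synthesisOp 𝕜 L Φ).closure.graph ↔
      ∀ f : (analysisOp 𝕜 Φ).domain, ⟪g, (f : X)⟫_𝕜 = ⟪c, analysisOp 𝕜 Φ f⟫_𝕜 := by
  rw [← ((isClosable_synthesisOp_iff L Φ).2 hd).graph_closure_eq_closure_graph,
    mem_closure_graph_synthesisOp_iff]

lemma IsLowerFrameSequence.isClosed_ran_analysisOp {Φ : I → X} (hΦ : IsLowerFrameSequence 𝕜 Φ) :
    IsClosed (ran (analysisOp 𝕜 Φ) : Set (ell2 𝕜 I)) := by
  obtain ⟨A, hA, h⟩ := hΦ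
  have hs := Real.sqrt_pos.2 hA
  let Γ := (analysisOp 𝕜 Φ).graph
  have : CompleteSpace Γ := (isClosed_graph_analysisOp Φ).completeSpace_coe
  let s : Γ →L[𝕜] ell2 𝕜 I := (ContinuousLinearMap.snd 𝕜 X (ell2 𝕜 I)).comp Γ.subtypeL
  have hanti : AntilipschitzWith (Real.toNNReal (max 1 (√A)⁻¹)) s := by
    refine AddMonoidHomClass.antilipschitz_of_bound s ?_
    rintro ⟨⟨f, c⟩, hp⟩
    obtain ⟨v, rfl, rfl⟩ := (LinearPMap.mem_graph_iff _).1 hp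
    rw [Real.coe_toNNReal _ (by positivity)]
    change max ‖(v : X)‖ ‖analysisOp 𝕜 Φ v‖ ≤ _ * ‖analysisOp 𝕜 Φ v‖
    refine max_le ?_ ?_
    · calc ‖(v : X)‖ ≤ (√A)⁻¹ * ‖analysisOp 𝕜 Φ v‖ := by
            rw [← div_eq_inv_mul, le_div_iff₀ hs, mul_comm]
            exact h v
        _ ≤ _ := by gcongr; exact le_max_right _ _
    · exact le_mul_of_one_le_left (norm_nonneg _) (le_max_left _ _)
  have hr : (ran (analysisOp 𝕜 Φ) : Set (ell2 𝕜 I)) = Set.range s := by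
    ext c
    rw [SetLike.mem_coe, mem_ran_iff]
    constructor
    · rintro ⟨f, hf⟩
      exact ⟨⟨_, hf⟩, rfl⟩
    · rintro ⟨⟨⟨f, c⟩, hf⟩, rfl⟩
      exact ⟨f, hf⟩
  rw [hr]
  exact hanti.isClosed_range s.uniformContinuous

/-- Weak solvability of `C* C u = g`. -/
lemma IsLowerFrameSequence.exists_inner_analysisOp_eq {Φ : I → X}
    (hΦ : IsLowerFrameSequence 𝕜 Φ) (g : X) :
    ∃ u : (analysisOp 𝕜 Φ).domain, ∀ h : (analysisOp 𝕜 Φ).domain,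
      ⟪analysisOp 𝕜 Φ u, analysisOp 𝕜 Φ h⟫_𝕜 = ⟪g, (h : X)⟫_𝕜 := by
  have : CompleteSpace (ran (analysisOp 𝕜 Φ)) := hΦ.isClosed_ran_analysisOp.completeSpace_coe
  let e : (analysisOp 𝕜 Φ).domain ≃ₗ[𝕜] ran (analysisOp 𝕜 Φ) :=
    LinearEquiv.ofInjective _ hΦ.injective_analysisOp
  obtain ⟨A, hA, hlow⟩ := hΦ
  have hs := Real.sqrt_pos.2 hA
  let ℓ : StrongDual 𝕜 (ran (analysisOp 𝕜 Φ)) :=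
    LinearMap.mkContinuous ((innerₛₗ 𝕜 g) ∘ₗ (analysisOp 𝕜 Φ).domain.subtype ∘ₗ e.symm.toLinearMap)
      (‖g‖ * (√A)⁻¹) (by
        intro y
        obtain ⟨v, rfl⟩ := e.surjective y
        have h1 : ‖(v : X)‖ ≤ (√A)⁻¹ * ‖e v‖ := by
          rw [← div_eq_inv_mul, le_div_iff₀ hs, mul_comm]
          exact hlow v
        simp only [LinearMap.comp_apply, LinearEquiv.coe_coe, e.symm_apply_apply]
        calc ‖⟪g, (v : X)⟫_𝕜‖ ≤ ‖g‖ * ‖(v : X)‖ := norm_inner_le_norm _ _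
          _ ≤ ‖g‖ * ((√A)⁻¹ * ‖e v‖) := by gcongr
          _ = _ := by ring)
  obtain ⟨u, hu⟩ := e.surjective ((InnerProductSpace.toDual 𝕜 _).symm ℓ)
  refine ⟨u, fun h => ?_⟩
  have h1 : ⟪e u, e h⟫_𝕜 = ℓ (e h) := by rw [hu, InnerProductSpace.toDual_symm_apply]
  have h2 : ℓ (e h) = ⟪g, (h : X)⟫_𝕜 := by
    change ⟪g, ((e.symm (e h) : (analysisOp 𝕜 Φ).domain) : X)⟫_𝕜 = _
    rw [e.symm_apply_apply]
  exact h1.trans h2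

/-- If `Φ' i` solves `C* C Φ' i = Φ i` weakly, then the closed synthesis operator of `Φ` has the
analysis operator of `Φ'` as its only pseudo-inverse. -/
theorem IsLowerFrameSequence.exists_pseudoInverse (L : SummationFilter I) [L.NeBot] [L.LeAtTop]
    {Φ : I → X} (hΦ : IsLowerFrameSequence 𝕜 Φ) (hd : Dense ((analysisOp 𝕜 Φ).domain : Set X))
    (Φ' : I → X)
    (hΦ' : ∀ i, ∃ u : (analysisOp 𝕜 Φ).domain, (u : X) = Φ' i ∧
      ∀ h : (analysisOp 𝕜 Φ).domain, ⟪analysisOp 𝕜 Φ u, analysisOp 𝕜 Φ h⟫_𝕜 = ⟪Φ i, (h : X)⟫_𝕜) :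
    ∃ S : X →ₗ[𝕜] ell2 𝕜 I, (∀ f i, S f i = ⟪Φ' i, f⟫_𝕜) ∧
      ∀ S', IsPseudoInverse (synthesisOp 𝕜 L Φ).closure S' ↔ S' = S.toPMap ⊤ := by
  choose u hu using hΦ.exists_inner_analysisOp_eq
  have hcoeff : ∀ g i, (analysisOp 𝕜 Φ (u g) : ell2 𝕜 I) i = ⟪Φ' i, g⟫_𝕜 := by
    intro g i
    obtain ⟨v, hv, hv'⟩ := hΦ' i
    rw [analysisOp_apply, ← hv', ← inner_conj_symm, hu, inner_conj_symm, hv]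
  let S : X →ₗ[𝕜] ell2 𝕜 I :=
    { toFun := fun g => analysisOp 𝕜 Φ (u g)
      map_add' := fun f g => by
        ext i
        simp only [lp.coeFn_add, Pi.add_apply, hcoeff, inner_add_right]
      map_smul' := fun a f => by
        ext i
        simp only [lp.coeFn_smul, Pi.smul_apply, hcoeff, inner_smul_right, RingHom.id_apply,
          smul_eq_mul] }
  have hS : ∀ g (h : (analysisOp 𝕜 Φ).domain), ⟪S g, analysisOp 𝕜 Φ h⟫_𝕜 = ⟪g, (h : X)⟫_𝕜 := hu
  have hgraph : ∀ g, (S g, g) ∈ (synthesisOp 𝕜 L Φ).closure.graph := fun g =>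
    (mem_graph_closure_synthesisOp_iff L hd).2 fun f => (hS g f).symm
  have hnull : nullSpace (synthesisOp 𝕜 L Φ).closure = (ran (analysisOp 𝕜 Φ))ᗮ := by
    ext c
    rw [mem_nullSpace_iff, mem_graph_closure_synthesisOp_iff L hd, Submodule.mem_orthogonal']
    constructor
    · rintro h _ ⟨f, rfl⟩
      simpa using (h f).symm
    · intro h f
      simpa using (h _ ⟨f, rfl⟩).symm
  have hcomp : CompleteSpace (ran (analysisOp 𝕜 Φ)) := hΦ.isClosed_ran_analysisOp.completeSpace_coe
  refine ⟨S, hcoeff, isPseudoInverse_iff_eq_toPMap hgraph ?_⟩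
  rw [hnull, ← Submodule.orthogonal_orthogonal_eq_closure]
  congr 1
  refine le_antisymm (fun c hc => ?_) (Submodule.orthogonal_le ?_)
  · obtain ⟨_, ⟨v, rfl⟩, d, hd', rfl⟩ := (ran (analysisOp 𝕜 Φ)).exists_add_mem_mem_orthogonal c
    have hv : (v : X) = 0 := by
      refine ext_inner_left 𝕜 fun g => ?_
      have h1 := (Submodule.mem_orthogonal _ _).1 hc (S g) ⟨g, rfl⟩
      have h2 : ⟪S g, d⟫_𝕜 = 0 := (Submodule.mem_orthogonal _ _).1 hd' (S g) ⟨u g, rfl⟩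
      rw [inner_add_right, h2, add_zero] at h1
      rw [inner_zero_right, ← hS g v]
      exact h1
    obtain rfl : v = 0 := Subtype.ext hv
    simpa using hd'
  · rintro _ ⟨g, rfl⟩
    exact ⟨u g, rfl⟩

lemma mem_graph_adjoint_comp_analysisOp_iff {Φ : I → X}
    (hd : Dense ((analysisOp 𝕜 Φ).domain : Set X)) {f g : X} :
    (f, g) ∈ (pcomp (analysisOp 𝕜 Φ).adjoint (analysisOp 𝕜 Φ)).graph ↔
      ∃ u : (analysisOp 𝕜 Φ).domain, (u : X) = f ∧ ∀ h : (analysisOp 𝕜 Φ).domain,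
        ⟪analysisOp 𝕜 Φ u, analysisOp 𝕜 Φ h⟫_𝕜 = ⟪g, (h : X)⟫_𝕜 := by
  rw [mem_graph_pcomp_iff]
  have key : ∀ c : ell2 𝕜 I, (c, g) ∈ (analysisOp 𝕜 Φ).adjoint.graph ↔
      ∀ h : (analysisOp 𝕜 Φ).domain, ⟪c, analysisOp 𝕜 Φ h⟫_𝕜 = ⟪g, (h : X)⟫_𝕜 := by
    intro c
    rw [LinearPMap.adjoint_graph_eq_graph_adjoint hd, Submodule.mem_adjoint_iff]
    constructor
    · intro H h
      rw [← inner_conj_symm, sub_eq_zero.1 (H _ _ (LinearPMap.mem_graph _ h)), inner_conj_symm]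
    · intro H a b hab
      obtain ⟨h, rfl, rfl⟩ := (LinearPMap.mem_graph_iff _).1 hab
      rw [sub_eq_zero, ← inner_conj_symm, H h, inner_conj_symm]
  constructor
  · rintro ⟨c, h1, h2⟩
    obtain ⟨v, rfl, rfl⟩ := (LinearPMap.mem_graph_iff _).1 h1
    exact ⟨v, rfl, (key _).1 h2⟩
  · rintro ⟨v, rfl, h⟩
    exact ⟨_, LinearPMap.mem_graph _ v, (key _).2 h⟩

lemma IsLowerFrameSequence.bijective_adjoint_comp_analysisOp {Φ : I → X}
    (hΦ : IsLowerFrameSequence 𝕜 Φ) (hd : Dense ((analysisOp 𝕜 Φ).domain : Set X)) :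
    Function.Bijective (pcomp (analysisOp 𝕜 Φ).adjoint (analysisOp 𝕜 Φ)) := by
  constructor
  · refine (injective_iff_map_eq_zero
      (pcomp (analysisOp 𝕜 Φ).adjoint (analysisOp 𝕜 Φ)).toFun).2 fun f hf => ?_
    have h := LinearPMap.mem_graph _ f
    obtain ⟨u, hu, h⟩ := (mem_graph_adjoint_comp_analysisOp_iff hd).1 h
    have h1 := h u
    rw [show pcomp (analysisOp 𝕜 Φ).adjoint (analysisOp 𝕜 Φ) f = 0 from hf, inner_zero_left,
      inner_self_eq_zero] at h1
    have h2 : u = 0 := hΦ.injective_analysisOp (h1.trans (map_zero _).symm)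
    exact Subtype.ext (hu.symm.trans (by rw [h2]; rfl))
  · intro g
    obtain ⟨u, hu⟩ := hΦ.exists_inner_analysisOp_eq g
    obtain ⟨v, -, hv⟩ := (LinearPMap.mem_graph_iff _).1
      ((mem_graph_adjoint_comp_analysisOp_iff hd).2 ⟨u, rfl, hu⟩)
    exact ⟨v, hv⟩

end Family

section Restriction

variable {𝕜 H I : Type*} [RCLike 𝕜] [NormedAddCommGroup H] [InnerProductSpace 𝕜 H]
  [CompleteSpace H]

lemma inner_restrictSeq (Ψ : I → H) (i : I) (f : spaceOf 𝕜 Ψ) :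
    ⟪restrictSeq 𝕜 Ψ i, f⟫_𝕜 = ⟪Ψ i, (f : H)⟫_𝕜 :=
  Submodule.inner_orthogonalProjectionOnto_eq_of_mem_right _ _

lemma mem_domain_analysisOp_restrictSeq_iff (Ψ : I → H) (f : spaceOf 𝕜 Ψ) :
    f ∈ (analysisOp 𝕜 (restrictSeq 𝕜 Ψ)).domain ↔ (f : H) ∈ (analysisOp 𝕜 Ψ).domain := by
  change Memℓp (fun i => ⟪restrictSeq 𝕜 Ψ i, f⟫_𝕜) 2 ↔ Memℓp (fun i => ⟪Ψ i, (f : H)⟫_𝕜) 2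
  simp only [inner_restrictSeq]

lemma analysisOp_restrictSeq_apply (Ψ : I → H) (f : spaceOf 𝕜 Ψ)
    (hf : f ∈ (analysisOp 𝕜 (restrictSeq 𝕜 Ψ)).domain) (hf' : (f : H) ∈ (analysisOp 𝕜 Ψ).domain) :
    analysisOp 𝕜 (restrictSeq 𝕜 Ψ) ⟨f, hf⟩ = analysisOp 𝕜 Ψ ⟨f, hf'⟩ := by
  ext i
  rw [analysisOp_apply, analysisOp_apply]
  exact inner_restrictSeq Ψ i f

lemma dense_domain_analysisOp_restrictSeq (Ψ : I → H) :
    Dense ((analysisOp 𝕜 (restrictSeq 𝕜 Ψ)).domain : Set (spaceOf 𝕜 Ψ)) := by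
  intro f
  rw [closure_subtype]
  refine closure_mono ?_ f.2
  intro g hg
  exact ⟨⟨g, Submodule.le_topologicalClosure _ hg⟩,
    (mem_domain_analysisOp_restrictSeq_iff Ψ _).2 hg, rfl⟩

lemma IsLowerFrameSequence.restrictSeq {Ψ : I → H} (hΨ : IsLowerFrameSequence 𝕜 Ψ) :
    IsLowerFrameSequence 𝕜 (restrictSeq 𝕜 Ψ) := by
  obtain ⟨A, hA, h⟩ := hΨ
  refine ⟨A, hA, fun ⟨f, hf⟩ => ?_⟩
  have hf' := (mem_domain_analysisOp_restrictSeq_iff Ψ f).1 hf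
  rw [analysisOp_restrictSeq_apply Ψ f hf hf']
  exact h ⟨(f : H), hf'⟩

lemma IsLowerFrameSequence.bijective_genFrameOp {Ψ : I → H} (hΨ : IsLowerFrameSequence 𝕜 Ψ) :
    Function.Bijective (genFrameOp 𝕜 Ψ) :=
  hΨ.restrictSeq.bijective_adjoint_comp_analysisOp (dense_domain_analysisOp_restrictSeq Ψ)

lemma IsLowerFrameSequence.canonicalDual_mem_graph {Ψ : I → H} (hΨ : IsLowerFrameSequence 𝕜 Ψ)
    (i : I) : (canonicalDual 𝕜 Ψ i, LowerFrame.restrictSeq 𝕜 Ψ i) ∈ (genFrameOp 𝕜 Ψ).graph := by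
  obtain ⟨v, hv⟩ := hΨ.bijective_genFrameOp.2 (LowerFrame.restrictSeq 𝕜 Ψ i)
  have hker : LinearMap.ker (genFrameOp 𝕜 Ψ).toFun = ⊥ :=
    LinearMap.ker_eq_bot.2 hΨ.bijective_genFrameOp.1
  have hmem : LowerFrame.restrictSeq 𝕜 Ψ i ∈ (genFrameOp 𝕜 Ψ).inverse.domain := by
    rw [LinearPMap.inverse_domain]
    exact ⟨v, hv⟩
  have : canonicalDual 𝕜 Ψ i = v := by
    rw [canonicalDual, dif_pos hmem]
    exact LinearPMap.inverse_apply_eq hker hv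
  exact (LinearPMap.mem_graph_iff _).2 ⟨v, this.symm, hv⟩

lemma IsLowerFrameSequence.canonicalDual_spec {Ψ : I → H} (hΨ : IsLowerFrameSequence 𝕜 Ψ) (i : I) :
    ∃ u : (analysisOp 𝕜 (LowerFrame.restrictSeq 𝕜 Ψ)).domain,
      (u : spaceOf 𝕜 Ψ) = canonicalDual 𝕜 Ψ i ∧
      ∀ h : (analysisOp 𝕜 (LowerFrame.restrictSeq 𝕜 Ψ)).domain,
        ⟪analysisOp 𝕜 (LowerFrame.restrictSeq 𝕜 Ψ) u,
          analysisOp 𝕜 (LowerFrame.restrictSeq 𝕜 Ψ) h⟫_𝕜 =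
        ⟪LowerFrame.restrictSeq 𝕜 Ψ i, (h : spaceOf 𝕜 Ψ)⟫_𝕜 :=
  (mem_graph_adjoint_comp_analysisOp_iff (dense_domain_analysisOp_restrictSeq Ψ)).1
    (hΨ.canonicalDual_mem_graph i)

end Restriction

end LowerFrame

theorem mainTheorem11 {𝕜 H I : Type*} [RCLike 𝕜] [NormedAddCommGroup H] [InnerProductSpace 𝕜 H]
    [CompleteSpace H] [Countable I] (L : SummationFilter I) [L.NeBot] [L.LeAtTop]
    (Ψ : I → H) (hΨ : LowerFrame.IsLowerFrameSequence 𝕜 Ψ) :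
    -- the canonical dual is well defined, and so is the closure of the restricted synthesis operator
    Function.Bijective (LowerFrame.genFrameOp 𝕜 Ψ) ∧
    (LowerFrame.synthesisOpR 𝕜 L Ψ).IsClosable ∧
    -- the pseudo-inverse of that closure exists, is unique, and is given by the coefficients
    (∃ S : LowerFrame.spaceOf 𝕜 Ψ →ₗ[𝕜] LowerFrame.ell2 𝕜 I,
      (∀ f i, S f i = ⟪LowerFrame.canonicalDual 𝕜 Ψ i, f⟫_𝕜) ∧
      ∀ S', LowerFrame.IsPseudoInverse (LowerFrame.synthesisOpR 𝕜 L Ψ).closure S' ↔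
        S' = S.toPMap ⊤) ∧
    -- the case of a closable synthesis operator
    ((LowerFrame.synthesisOp 𝕜 L Ψ).IsClosable →
      ∃ S : H →ₗ[𝕜] LowerFrame.ell2 𝕜 I,
        (∀ f i, S f i = ⟪(LowerFrame.canonicalDual 𝕜 Ψ i : H), f⟫_𝕜) ∧
        ∀ S', LowerFrame.IsPseudoInverse (LowerFrame.synthesisOp 𝕜 L Ψ).closure S' ↔
          S' = S.toPMap ⊤) := by
  have hd := LowerFrame.dense_domain_analysisOp_restrictSeq (𝕜 := 𝕜) Ψ
  refine ⟨hΨ.bijective_genFrameOp, (LowerFrame.isClosable_synthesisOp_iff L _).2 hd,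
    hΨ.restrictSeq.exists_pseudoInverse L hd _ hΨ.canonicalDual_spec, fun hc => ?_⟩
  refine hΨ.exists_pseudoInverse L ((LowerFrame.isClosable_synthesisOp_iff L _).1 hc) _ fun i => ?_
  obtain ⟨⟨u, hm⟩, hu, h⟩ := hΨ.canonicalDual_spec i
  have hm' := (LowerFrame.mem_domain_analysisOp_restrictSeq_iff Ψ u).1 hm
  refine ⟨⟨(u : H), hm'⟩, congrArg Subtype.val hu, fun ⟨g, hg⟩ => ?_⟩
  have hgK : g ∈ LowerFrame.spaceOf 𝕜 Ψ := Submodule.le_topologicalClosure _ hg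
  have hgm := (LowerFrame.mem_domain_analysisOp_restrictSeq_iff Ψ ⟨g, hgK⟩).2 hg
  have h1 := h ⟨⟨g, hgK⟩, hgm⟩
  rwa [LowerFrame.analysisOp_restrictSeq_apply Ψ u hm hm',
    LowerFrame.analysisOp_restrictSeq_apply Ψ ⟨g, hgK⟩ hgm hg,
    LowerFrame.inner_restrictSeq] at h1
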